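/- Let $\Delta\subset\mathbb C$ be the open unit disc and let $\Omega\subset\mathbb C^d$ be a bounded domain (nonempty, open, connected). Let $\delta_\Omega(x)$ be the Euclidean distance from $x$ to $\partial\Omega$, let $$k_\Omega(x;v)=\inf\{|\xi| : f:\Delta\to\Omega \text{ holomorphic},\ f(0)=x,\ \xi f'(0)=v\}$$ be the infinitesimal Kobayashi metric, let $K_\Omega$ be the Kobayashi distance (the infimum of $\sum_{i=1}^n\rho_\Delta(\zeta_{i-1},\zeta_i)$ over analytic chains of holomorphic maps $\phi_i:\Delta\to\Omega$ and points $\zeta_i\in\Delta$ with $\phi_1(\zeta_0)=x$, $\phi_n(\zeta_n)=y$ and $\phi_i(\zeta_i)=\phi_{i+1}(\zeta_i)$ for $1\le i<n$, where $\rho_\Delta$ is the Poincaré distance on $\Delta$ with infinitesimal form $|d\zeta|/(1-|\zeta|^2)$), and let $$M_\Omega(r)=\sup\{1/k_\Omega(x;v) : x\in\Omega,\ \delta_\Omega(x)\le r,\ \|v\|=1\}.$$ The domain $\Omega$ is a Goldilocks domain if 1. $\int_0^\epsilon \frac1r M_\Omega(r)\,dr<\infty$ for some $\epsilon>0$, and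 2. for each $x_0\in\Omega$ there are constants $C,\alpha>0$ such that $K_\Omega(x_0,x)\le C+\alpha\log\frac1{\delta_\Omega(x)}$ for all $x\in\Omega$. Then every Goldilocks domain is pseudoconvex, i.e. admits a continuous plurisubharmonic exhaustion function. In fact Condition 1 alone suffices: if a bounded domain $\Omega\subset\mathbb C^d$ satisfies Condition 1, then $\Omega$ is pseudoconvex, and it satisfies the continuity principle: for every continuous $\Phi:\overline\Delta\times[0,1]\to\mathbb C^d$ such that $\Phi(\cdot,t)|_\Delta$ is holomorphic for each $t\in[0,1]$ and $\Phi(\Delta\times\{0\}\cup\partial\Delta\times[0,1])\subset\Omega$, one has $\Phi(\Delta\times[0,1])\subset\Omega$. -/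

import Mathlib

open scoped ENNReal ComplexConjugate

namespace Goldilocks

noncomputable section

/-- `ℂ^d` with its standard Euclidean norm. -/
abbrev Cd (d : ℕ) := EuclideanSpace ℂ (Fin d)

/-- A bounded domain: a bounded, nonempty, connected open subset of `ℂ^d`. -/
def IsBoundedDomain {d : ℕ} (Ω : Set (Cd d)) : Prop :=
  IsOpen Ω ∧ IsConnected Ω ∧ Bornology.IsBounded Ω

/-- `f` is (the restriction to the open unit disc of) a holomorphic map into `Ω`. -/
def IsHolDisc {d : ℕ} (Ω : Set (Cd d)) (f : ℂ → Cd d) : Prop :=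
  DifferentiableOn ℂ f (Metric.ball 0 1) ∧ Set.MapsTo f (Metric.ball 0 1) Ω

/-- The infinitesimal Kobayashi (Kobayashi--Royden) metric
`k_Ω(x; v) = inf { |ξ| : f : Δ → Ω holomorphic, f(0) = x, ξ f'(0) = v }`. -/
def kobMetric {d : ℕ} (Ω : Set (Cd d)) (x v : Cd d) : ℝ≥0∞ :=
  sInf {s : ℝ≥0∞ | ∃ (f : ℂ → Cd d) (ξ : ℂ),
    IsHolDisc Ω f ∧ f 0 = x ∧ ξ • deriv f 0 = v ∧ s = ENNReal.ofReal ‖ξ‖}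

/-- The Poincaré distance on the unit disc whose infinitesimal form is `|dζ| / (1 - |ζ|²)`. -/
def poincareDist (z w : ℂ) : ℝ :=
  Real.artanh ‖(z - w) / (1 - conj w * z)‖

/-- `(φ 1, …, φ n; ζ 0, …, ζ n)` is an analytic chain in `Ω` joining `x` to `y`. -/
def IsAnalyticChain {d : ℕ} (Ω : Set (Cd d)) (x y : Cd d) (n : ℕ)
    (φ : ℕ → ℂ → Cd d) (ζ : ℕ → ℂ) : Prop :=
  1 ≤ n ∧
  (∀ i, 1 ≤ i → i ≤ n → IsHolDisc Ω (φ i)) ∧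
  (∀ i, i ≤ n → ζ i ∈ Metric.ball (0 : ℂ) 1) ∧
  φ 1 (ζ 0) = x ∧
  φ n (ζ n) = y ∧
  (∀ i, 1 ≤ i → i < n → φ i (ζ i) = φ (i + 1) (ζ i))

/-- The Kobayashi (pseudo-)distance: the infimum of the total Poincaré length of analytic chains
joining `x` to `y`. -/
def kobDist {d : ℕ} (Ω : Set (Cd d)) (x y : Cd d) : ℝ≥0∞ :=
  sInf {s : ℝ≥0∞ | ∃ (n : ℕ) (φ : ℕ → ℂ → Cd d) (ζ : ℕ → ℂ), IsAnalyticChain Ω x y n φ ζ ∧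
    s = ENNReal.ofReal (∑ i ∈ Finset.range n, poincareDist (ζ i) (ζ (i + 1)))}

/-- The Euclidean distance from `x` to the boundary of `Ω`. -/
def bdryDist {d : ℕ} (Ω : Set (Cd d)) (x : Cd d) : ℝ :=
  Metric.infDist x (frontier Ω)

/-- `M_Ω(r) = sup { 1 / k_Ω(x; v) : x ∈ Ω, δ_Ω(x) ≤ r, ‖v‖ = 1 }`. -/
def growth {d : ℕ} (Ω : Set (Cd d)) (r : ℝ) : ℝ≥0∞ :=
  sSup {s : ℝ≥0∞ | ∃ x ∈ Ω, ∃ v : Cd d, bdryDist Ω x ≤ r ∧ ‖v‖ = 1 ∧ s = (kobMetric Ω x v)⁻¹}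

/-- Condition 1: `∫_0^ε M_Ω(r) / r dr < ∞` for some `ε > 0`. -/
def Condition1 {d : ℕ} (Ω : Set (Cd d)) : Prop :=
  ∃ ε : ℝ, 0 < ε ∧ ∫⁻ r in Set.Ioc 0 ε, growth Ω r / ENNReal.ofReal r < ∞

/-- Condition 2: `K_Ω(x₀, x) ≤ C + α log (1 / δ_Ω(x))` on `Ω`, with constants depending on `x₀`. -/
def Condition2 {d : ℕ} (Ω : Set (Cd d)) : Prop :=
  ∀ x₀ ∈ Ω, ∃ C α : ℝ, 0 < C ∧ 0 < α ∧ ∀ x ∈ Ω,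
    (kobDist Ω x₀ x : EReal) ≤ ((C + α * Real.log (1 / bdryDist Ω x) : ℝ) : EReal)

/-- A Goldilocks domain: a bounded domain satisfying Conditions 1 and 2. -/
def IsGoldilocks {d : ℕ} (Ω : Set (Cd d)) : Prop :=
  IsBoundedDomain Ω ∧ Condition1 Ω ∧ Condition2 Ω

/-- `u` is a continuous plurisubharmonic function on `Ω`: it is continuous on `Ω` and satisfies
the sub-mean value inequality on every closed affine complex disc contained in `Ω`. -/
def IsContPlurisubharmonic {d : ℕ} (Ω : Set (Cd d)) (u : Cd d → ℝ) : Prop :=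
  ContinuousOn u Ω ∧
  ∀ a b : Cd d, (∀ ζ ∈ Metric.closedBall (0 : ℂ) 1, a + ζ • b ∈ Ω) →
    u a ≤ Real.circleAverage (fun ζ : ℂ => u (a + ζ • b)) 0 1

/-- An open set `Ω ⊆ ℂ^d` is pseudoconvex if it admits a continuous plurisubharmonic exhaustion
function. -/
def IsPseudoconvex {d : ℕ} (Ω : Set (Cd d)) : Prop :=
  IsOpen Ω ∧ ∃ u : Cd d → ℝ, IsContPlurisubharmonic Ω u ∧
    ∀ c : ℝ, IsCompact {z : Cd d | z ∈ Ω ∧ u z ≤ c}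

/-- The continuity principle for `Ω`: if `Φ : closure Δ × [0,1] → ℂ^d` is continuous, holomorphic
on `Δ` for each fixed `t`, and maps `Δ × {0} ∪ ∂Δ × [0,1]` into `Ω`, then it maps `Δ × [0,1]`
into `Ω`. -/
def ContinuityPrinciple {d : ℕ} (Ω : Set (Cd d)) : Prop :=
  ∀ Φ : ℂ × ℝ → Cd d,
    ContinuousOn Φ (Metric.closedBall (0 : ℂ) 1 ×ˢ Set.Icc (0 : ℝ) 1) →
    (∀ t ∈ Set.Icc (0 : ℝ) 1, DifferentiableOn ℂ (fun ζ => Φ (ζ, t)) (Metric.ball 0 1)) →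
    (∀ ζ ∈ Metric.ball (0 : ℂ) 1, Φ (ζ, 0) ∈ Ω) →
    (∀ ζ ∈ Metric.sphere (0 : ℂ) 1, ∀ t ∈ Set.Icc (0 : ℝ) 1, Φ (ζ, t) ∈ Ω) →
    ∀ t ∈ Set.Icc (0 : ℝ) 1, ∀ ζ ∈ Metric.ball (0 : ℂ) 1, Φ (ζ, t) ∈ Ω

end

end Goldilocks

namespace Goldilocks

open Set Metric Filter Topology MeasureTheory

variable {d : ℕ} {Ω : Set (Cd d)}

/-! A disc in `Ω` passing near the boundary with velocity bounded below forces `growth` to stay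
bounded below there. As `dr / r` has infinite mass at 0, Condition 1 forbids this for arbitrarily
small `r`. Hence a family of discs that first leaves `Ω` at an interior point has zero derivative
there (`Condition1.deriv_eq_zero_of_contact`).

When `d ≥ 2`, critical contacts are removed by a generic linear tilt: the real multiples of the
velocities of one disc form a set of real dimension at most 3 < 2d. So a disc is no closer to the
complement than its boundary circle (`ball_subset_of_disc`); for `d = 1` this is the minimum modulus
principle. The uniform estimate gives the continuity principle, and Hartogs' argument then makes
`-log δ_Ω` plurisubharmonic; it is an exhaustion because `Ω` is bounded. -/

/-! ### Condition 1 and lower bounds on the growth function -/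

/-- The disc of radius `1 - ‖ζ‖` about `ζ` lies in the unit disc; rescaling `f` on it gives a
competitor for the Kobayashi metric at `f ζ` in the direction of `w`. -/
theorem le_growth_of_isHolDisc {f : ℂ → Cd d} (hf : IsHolDisc Ω f) {ζ : ℂ}
    (hζ : ζ ∈ ball (0 : ℂ) 1) {w : Cd d} (hw : HasDerivAt f w ζ) {r : ℝ}
    (hr : bdryDist Ω (f ζ) ≤ r) :
    ENNReal.ofReal ((1 - ‖ζ‖) * ‖w‖) ≤ growth Ω r := by
  rcases eq_or_ne w 0 with rfl | hw0
  · simp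
  have hζ1 : 0 < 1 - ‖ζ‖ := by simpa using hζ
  have hwn : 0 < ‖w‖ := norm_pos_iff.2 hw0
  set ρ : ℝ := 1 - ‖ζ‖ with hρ
  have hmaps : MapsTo (fun z : ℂ => ζ + (ρ : ℂ) * z) (ball 0 1) (ball 0 1) := by
    intro z hz
    rw [mem_ball_zero_iff] at hz ⊢
    calc ‖ζ + (ρ : ℂ) * z‖ ≤ ‖ζ‖ + ‖(ρ : ℂ) * z‖ := norm_add_le _ _
      _ = ‖ζ‖ + ρ * ‖z‖ := by rw [norm_mul, Complex.norm_real, Real.norm_of_nonneg hζ1.le]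
      _ < ‖ζ‖ + ρ * 1 := by gcongr
      _ = 1 := by rw [hρ]; ring
  have hg : HasDerivAt (fun z : ℂ => f (ζ + (ρ : ℂ) * z)) ((ρ : ℂ) • w) 0 := by
    have h1 : HasDerivAt (fun z : ℂ => ζ + (ρ : ℂ) * z) (ρ : ℂ) 0 := by
      simpa using ((hasDerivAt_id (0 : ℂ)).const_mul (ρ : ℂ)).const_add ζ
    have h2 : HasDerivAt f w (ζ + (ρ : ℂ) * 0) := by simpa using hw
    exact h2.scomp (0 : ℂ) h1
  have hk : kobMetric Ω (f ζ) (((‖w‖⁻¹ : ℝ) : ℂ) • w) ≤ ENNReal.ofReal (ρ * ‖w‖)⁻¹ := by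
    refine sInf_le ⟨fun z => f (ζ + (ρ : ℂ) * z), (((ρ * ‖w‖)⁻¹ : ℝ) : ℂ), ⟨?_, ?_⟩, ?_, ?_, ?_⟩
    · exact hf.1.comp (by fun_prop) hmaps
    · exact hf.2.comp hmaps
    · simp
    · rw [hg.deriv, smul_smul, ← Complex.ofReal_mul]
      congr 2
      field_simp
    · rw [Complex.norm_real, Real.norm_of_nonneg (by positivity)]
  have hle : (kobMetric Ω (f ζ) (((‖w‖⁻¹ : ℝ) : ℂ) • w))⁻¹ ≤ growth Ω r := by
    refine le_sSup ⟨f ζ, hf.2 hζ, _, hr, ?_, rfl⟩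
    rw [norm_smul, Complex.norm_real, norm_inv, norm_norm, inv_mul_cancel₀ hwn.ne']
  refine le_trans ?_ hle
  rw [ENNReal.le_inv_iff_le_inv, ← ENNReal.ofReal_inv_of_pos (by positivity)]
  exact hk

/-- A positive lower bound `κ` would make `κ / r` integrable at 0. -/
theorem Condition1.eq_zero_of_le_growth (h : Condition1 Ω) {κ : ℝ} (hκ : 0 ≤ κ)
    (hle : ∀ r, 0 < r → ENNReal.ofReal κ ≤ growth Ω r) : κ = 0 := by
  by_contra hne
  have hpos : 0 < κ := lt_of_le_of_ne hκ (Ne.symm hne)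
  obtain ⟨ε, hε, hint⟩ := h
  have hlt : ∫⁻ r in Ioc 0 ε, ENNReal.ofReal (κ * r⁻¹) < ∞ := by
    refine lt_of_le_of_lt (setLIntegral_mono' measurableSet_Ioc fun r hr => ?_) hint
    rw [ENNReal.ofReal_mul hκ, ENNReal.ofReal_inv_of_pos hr.1, div_eq_mul_inv]
    gcongr
    exact hle r hr.1
  have hI : IntegrableOn (fun r : ℝ => κ * r⁻¹) (Ioc 0 ε) := by
    refine ⟨by fun_prop, ?_⟩
    rw [hasFiniteIntegral_iff_ofReal]
    · exact hlt
    · filter_upwards [ae_restrict_mem measurableSet_Ioc] with r hr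
      have := hr.1
      positivity
  have hI2 : IntervalIntegrable (fun r : ℝ => r⁻¹) volume 0 ε := by
    rw [intervalIntegrable_iff_integrableOn_Ioc_of_le hε.le]
    have := hI.const_mul κ⁻¹
    simpa [IntegrableOn, ← mul_assoc, inv_mul_cancel₀ hne] using this
  rw [intervalIntegrable_inv_iff] at hI2
  rcases hI2 with h0 | h0
  · exact hε.ne h0
  · exact h0 (by simp)

/-! ### First contact with the complement -/

/-- A continuous family of closed discs which starts inside the open set `Ω` and does not stay
there has a first time of contact with the complement. -/
theorem exists_first_contact {Φ : ℂ × ℝ → Cd d} (hΩ : IsOpen Ω)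
    (hΦ : ContinuousOn Φ (closedBall (0 : ℂ) 1 ×ˢ Icc (0 : ℝ) 1))
    (h0 : ∀ ζ ∈ closedBall (0 : ℂ) 1, Φ (ζ, 0) ∈ Ω)
    (hbad : ∃ ζ ∈ closedBall (0 : ℂ) 1, ∃ t ∈ Icc (0 : ℝ) 1, Φ (ζ, t) ∉ Ω) :
    ∃ ζ ∈ closedBall (0 : ℂ) 1, ∃ t ∈ Ioc (0 : ℝ) 1, Φ (ζ, t) ∉ Ω ∧
      ∀ s ∈ Ico (0 : ℝ) t, ∀ z ∈ closedBall (0 : ℂ) 1, Φ (z, s) ∈ Ω := by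
  have hK : IsCompact (closedBall (0 : ℂ) 1 ×ˢ Icc (0 : ℝ) 1) :=
    (isCompact_closedBall 0 1).prod isCompact_Icc
  have hB : IsCompact ((closedBall (0 : ℂ) 1 ×ˢ Icc (0 : ℝ) 1) ∩ Φ ⁻¹' Ωᶜ) :=
    hK.of_isClosed_subset (hΦ.preimage_isClosed_of_isClosed hK.isClosed hΩ.isClosed_compl)
      inter_subset_left
  obtain ⟨ζ, hζ, t, ht, hn⟩ := hbad
  -- The bad parameters form a compact set, so an earliest bad time is attained.
  obtain ⟨⟨z, s⟩, ⟨⟨hz, hs⟩, hzs⟩, hmin⟩ :=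
    hB.exists_isMinOn ⟨(ζ, t), ⟨hζ, ht⟩, hn⟩ continuous_snd.continuousOn
  have hz' : z ∈ closedBall (0 : ℂ) 1 := hz
  have hs' : s ∈ Icc (0 : ℝ) 1 := hs
  refine ⟨z, hz', s, ⟨lt_of_le_of_ne hs'.1 ?_, hs'.2⟩, hzs, fun s' hs'' z' hz'' => ?_⟩
  · rintro rfl
    exact hzs (h0 z hz')
  · by_contra hbad'
    have := hmin (show (z', s') ∈ _ from ⟨⟨hz'', hs''.1, hs''.2.le.trans hs'.2⟩, hbad'⟩)
    exact absurd hs''.2 (not_lt.2 this)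

theorem tendsto_nhdsLT_of_continuousOn {Φ : ℂ × ℝ → Cd d}
    (hΦ : ContinuousOn Φ (closedBall (0 : ℂ) 1 ×ˢ Icc (0 : ℝ) 1)) {ζ : ℂ}
    (hζ : ζ ∈ closedBall (0 : ℂ) 1) {t : ℝ} (ht : t ∈ Ioc (0 : ℝ) 1) :
    Tendsto (fun s => Φ (ζ, s)) (𝓝[<] t) (𝓝 (Φ (ζ, t))) := by
  have h1 : ContinuousWithinAt (fun s => Φ (ζ, s)) (Icc 0 1) t :=
    (hΦ.comp (f := fun s : ℝ => (ζ, s)) (by fun_prop) fun s hs => ⟨hζ, hs⟩) t ⟨ht.1.le, ht.2⟩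
  refine h1.tendsto.mono_left ?_
  rw [← nhdsWithin_Ico_eq_nhdsLT ht.1]
  exact nhdsWithin_mono _ fun s hs => ⟨hs.1, hs.2.le.trans ht.2⟩

/-- At an interior point of first contact with the complement the discs are critical. -/
theorem Condition1.deriv_eq_zero_of_contact (hc1 : Condition1 Ω)
    {F : ℝ → ℂ → Cd d} {F' : ℝ → Cd d} {t : ℝ} {ζ : ℂ} (hζ : ζ ∈ ball (0 : ℂ) 1)
    (hF : ∀ᶠ s in 𝓝[<] t, IsHolDisc Ω (F s)) (hd : ∀ᶠ s in 𝓝[<] t, HasDerivAt (F s) (F' s) ζ)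
    (hFt : Tendsto (fun s => F s ζ) (𝓝[<] t) (𝓝 (F t ζ)))
    (hF't : Tendsto F' (𝓝[<] t) (𝓝 (F' t))) (hout : F t ζ ∉ Ω) : F' t = 0 := by
  have hζ1 : 0 < 1 - ‖ζ‖ := by simpa using hζ
  have hfr : F t ζ ∈ frontier Ω := by
    refine ⟨mem_closure_of_tendsto hFt (hF.mono fun s hs => hs.2 hζ), fun h => ?_⟩
    exact hout (interior_subset h)
  have hδ : Tendsto (fun s => bdryDist Ω (F s ζ)) (𝓝[<] t) (𝓝 0) := by
    have := ((continuous_infDist_pt (frontier Ω)).tendsto (F t ζ)).comp hFt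
    rwa [infDist_zero_of_mem hfr] at this
  by_contra hne
  have hpos : 0 < ‖F' t‖ := norm_pos_iff.2 hne
  -- Just before contact the speed exceeds half its limit while the boundary distance is below any
  -- given `r`.
  have := hc1.eq_zero_of_le_growth (κ := (1 - ‖ζ‖) * (‖F' t‖ / 2)) (by positivity) fun r hr => by
    have h1 : ∀ᶠ s in 𝓝[<] t, ‖F' t‖ / 2 < ‖F' s‖ := hF't.norm.eventually_const_lt (by linarith)
    obtain ⟨s, hs, hs1, hs2, hs3⟩ :=
      (hF.and (h1.and (hd.and (hδ.eventually_lt_const hr)))).exists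
    refine le_trans (ENNReal.ofReal_le_ofReal ?_) (le_growth_of_isHolDisc hs hζ hs2 hs3.le)
    gcongr
  exact absurd this (by positivity)

/-! ### Distance to the complement along a disc -/

/-- A vector in general position with respect to the real cone over the velocities of a
holomorphic disc in dimension at least two. -/
theorem exists_small_notMem_cone_deriv (hd : 2 ≤ d) {φ : ℂ → Cd d}
    (hφ : DifferentiableOn ℂ φ (ball 0 1)) {η : ℝ} (hη : 0 < η) :
    ∃ a : Cd d, ‖a‖ < η ∧ ∀ τ : ℝ, ∀ ζ ∈ ball (0 : ℂ) 1, τ • deriv φ ζ ≠ a := by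
  have hsm : ContDiffOn ℝ 1 (fun p : ℝ × ℂ => p.1 • deriv φ p.2)
      (univ ×ˢ ball (0 : ℂ) 1) := by
    have h1 : ContDiffOn ℝ 1 (deriv φ) (ball 0 1) :=
      ((hφ.deriv isOpen_ball).contDiffOn isOpen_ball).restrict_scalars ℝ
    exact contDiffOn_fst.smul (h1.comp contDiffOn_snd fun p hp => hp.2)
  have hconv : Convex ℝ ((univ : Set ℝ) ×ˢ ball (0 : ℂ) 1) := convex_univ.prod (convex_ball 0 1)
  -- The parameter space ℝ × ℂ has real dimension 3, the target 2d ≥ 4; a C¹ image cannot fill an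
  -- open set.
  have hdim : dimH ((univ : Set ℝ) ×ˢ ball (0 : ℂ) 1) < Module.finrank ℝ (Cd d) := by
    refine (dimH_mono (subset_univ _)).trans_lt ?_
    rw [Real.dimH_univ_eq_finrank, Nat.cast_lt, Module.finrank_prod, Module.finrank_self,
      Complex.finrank_real_complex, ← Module.finrank_mul_finrank ℝ ℂ (Cd d),
      Complex.finrank_real_complex, finrank_euclideanSpace_fin]
    omega
  have hdense := hsm.dense_compl_image_of_dimH_lt_finrank hconv Subset.rfl hdim
  obtain ⟨a, ha, hmem⟩ := hdense.exists_dist_lt 0 hη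
  refine ⟨a, by simpa using hmem, fun τ ζ hζ h => ha ⟨(τ, ζ), ⟨trivial, hζ⟩, h⟩⟩

/-- If `p` in the ball were outside `Ω`, translating the disc to carry `φ ζ₀` to `p` would leave
`Ω`, at an interior point since the boundary circle has room `η`. A tilt vanishing at `ζ₀` makes
this contact noncritical. -/
theorem ball_subset_of_disc_of_two_le (hd : 2 ≤ d) (hΩ : IsOpen Ω) (hc1 : Condition1 Ω)
    {φ : ℂ → Cd d} (hφc : ContinuousOn φ (closedBall 0 1)) (hφ : DifferentiableOn ℂ φ (ball 0 1))
    (hφΩ : MapsTo φ (closedBall 0 1) Ω) {η : ℝ}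
    (hη : ∀ ζ ∈ sphere (0 : ℂ) 1, ball (φ ζ) η ⊆ Ω) {ζ₀ : ℂ} (hζ₀ : ζ₀ ∈ ball (0 : ℂ) 1) :
    ball (φ ζ₀) η ⊆ Ω := by
  intro p hp
  by_contra hpΩ
  set c : Cd d := p - φ ζ₀ with hc
  have hcη : ‖c‖ < η := by rwa [mem_ball_iff_norm] at hp
  -- Since `‖ζ - ζ₀‖ ≤ 2`, this bound on `a` keeps the total displacement `‖c‖ + 2‖a‖` below `η`.
  obtain ⟨a, ha, hav⟩ := exists_small_notMem_cone_deriv hd hφ (η := (η - ‖c‖) / 2) (by linarith)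
  set Φ : ℂ × ℝ → Cd d := fun q => φ q.1 + q.2 • (c + (q.1 - ζ₀) • a) with hΦ
  have hΦc : ContinuousOn Φ (closedBall (0 : ℂ) 1 ×ˢ Icc (0 : ℝ) 1) := by
    refine ContinuousOn.add (hφc.comp continuousOn_fst fun q hq => hq.1) ?_
    exact Continuous.continuousOn (by fun_prop)
  obtain ⟨ζ, hζ, t, ht, hout, hin⟩ := exists_first_contact hΩ hΦc
    (fun ζ hζ => by simpa [hΦ] using hφΩ hζ)
    ⟨ζ₀, ball_subset_closedBall hζ₀, 1, by simp, by simpa [hΦ, hc] using hpΩ⟩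
  have hζ' : ζ ∈ ball (0 : ℂ) 1 := by
    by_contra hζn
    have hsph : ζ ∈ sphere (0 : ℂ) 1 := by
      rw [mem_closedBall_zero_iff] at hζ
      rw [mem_ball_zero_iff, not_lt] at hζn
      rw [mem_sphere_zero_iff_norm]
      exact le_antisymm hζ hζn
    refine hout (hη ζ hsph ?_)
    rw [mem_ball_iff_norm]
    have h1 : ‖ζ - ζ₀‖ ≤ 2 := by
      have h2 := norm_sub_le ζ ζ₀
      rw [mem_sphere_zero_iff_norm] at hsph
      rw [mem_ball_zero_iff] at hζ₀
      linarith
    calc ‖Φ (ζ, t) - φ ζ‖ = t * ‖c + (ζ - ζ₀) • a‖ := by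
          rw [hΦ, add_sub_cancel_left, norm_smul, Real.norm_of_nonneg ht.1.le]
      _ ≤ 1 * (‖c‖ + ‖ζ - ζ₀‖ * ‖a‖) := by
          gcongr
          · exact ht.2
          · exact (norm_add_le _ _).trans (by rw [norm_smul])
      _ ≤ ‖c‖ + 2 * ‖a‖ := by rw [one_mul]; gcongr
      _ < η := by linarith
  have hder : ∀ s : ℝ, HasDerivAt (fun z => Φ (z, s)) (deriv φ ζ + s • a) ζ := fun s => by
    have h1 : HasDerivAt φ (deriv φ ζ) ζ :=
      (hφ.differentiableAt (isOpen_ball.mem_nhds hζ')).hasDerivAt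
    have h2 : HasDerivAt (fun z : ℂ => c + (z - ζ₀) • a) a ζ := by
      simpa using (((hasDerivAt_id ζ).sub_const ζ₀).smul_const a).const_add c
    exact h1.add (h2.const_smul s)
  have hcrit := hc1.deriv_eq_zero_of_contact (F := fun s z => Φ (z, s))
    (F' := fun s => deriv φ ζ + s • a) (t := t) hζ' ?_ (.of_forall hder)
    (tendsto_nhdsLT_of_continuousOn hΦc hζ ht) ?_ hout
  -- A critical contact means `φ' = -t a`, putting `a` in the excluded cone.
  · refine hav (-t⁻¹) ζ hζ' ?_
    have h1 : deriv φ ζ = -(t • a) := eq_neg_of_add_eq_zero_left hcrit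
    rw [h1, smul_neg, neg_smul, neg_neg, smul_smul, inv_mul_cancel₀ ht.1.ne', one_smul]
  · have hmem : Ico (0 : ℝ) t ∈ 𝓝[<] t := Ico_mem_nhdsLT ht.1
    filter_upwards [hmem] with s hs
    refine ⟨?_, fun z hz => hin s hs z (ball_subset_closedBall hz)⟩
    have hlin : Differentiable ℂ fun z : ℂ => c + (z - ζ₀) • a := by fun_prop
    exact hφ.add (hlin.const_smul s).differentiableOn
  · have : Continuous fun s : ℝ => deriv φ ζ + s • a := by fun_prop
    exact this.continuousAt.tendsto.mono_left nhdsWithin_le_nhds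

/-- The general position argument fails in real dimension 2. Instead, for `p` outside `Ω` the
function `φ - p` has no zeros, and the maximum principle applies to its inverse. -/
theorem ball_subset_of_disc_of_dim_one {Ω : Set (Cd 1)}
    {φ : ℂ → Cd 1} (hφc : ContinuousOn φ (closedBall 0 1)) (hφ : DifferentiableOn ℂ φ (ball 0 1))
    (hφΩ : MapsTo φ (closedBall 0 1) Ω) {η : ℝ}
    (hη : ∀ ζ ∈ sphere (0 : ℂ) 1, ball (φ ζ) η ⊆ Ω) {ζ₀ : ℂ} (hζ₀ : ζ₀ ∈ ball (0 : ℂ) 1) :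
    ball (φ ζ₀) η ⊆ Ω := by
  intro p hp
  by_contra hpΩ
  have hη0 : 0 < η := pos_of_mem_ball hp
  have hnorm : ∀ x : Cd 1, ‖x‖ = ‖x 0‖ := fun x => by
    rw [EuclideanSpace.norm_eq]; simp
  set g : ℂ → ℂ := fun ζ => (φ ζ - p) 0 with hg
  have hproj : g = fun ζ => EuclideanSpace.proj (𝕜 := ℂ) (0 : Fin 1) (φ ζ - p) := rfl
  have hg0 : ∀ ζ ∈ closedBall (0 : ℂ) 1, g ζ ≠ 0 := fun ζ hζ h => by
    have h1 : ‖φ ζ - p‖ = 0 := by rw [hnorm]; exact norm_eq_zero.2 h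
    rw [norm_eq_zero, sub_eq_zero] at h1
    exact hpΩ (h1 ▸ hφΩ hζ)
  have hgd : DiffContOnCl ℂ g (ball 0 1) := by
    refine ⟨?_, ?_⟩
    · rw [hproj]
      exact (EuclideanSpace.proj (𝕜 := ℂ) (0 : Fin 1)).differentiable.comp_differentiableOn
        (hφ.sub_const p)
    · rw [closure_ball _ one_ne_zero, hproj]
      exact (EuclideanSpace.proj (𝕜 := ℂ) (0 : Fin 1)).continuous.comp_continuousOn
        (hφc.sub continuousOn_const)
  have hinv : DiffContOnCl ℂ g⁻¹ (ball 0 1) := hgd.inv (by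
    rwa [closure_ball _ one_ne_zero])
  have hle := Complex.norm_le_of_forall_mem_frontier_norm_le isBounded_ball hinv (C := η⁻¹)
    (fun ζ hζ => by
      rw [frontier_ball _ one_ne_zero] at hζ
      have h1 : η ≤ ‖g ζ‖ := by
        rw [hg, ← hnorm, ← dist_eq_norm, dist_comm]
        by_contra hlt
        exact hpΩ (hη ζ hζ (mem_ball.2 (not_le.1 hlt)))
      rw [Pi.inv_apply, norm_inv]
      gcongr) (subset_closure hζ₀)
  rw [Pi.inv_apply, norm_inv, inv_le_inv₀ (norm_pos_iff.2 (hg0 _ (ball_subset_closedBall hζ₀))) hη0,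
    hg, ← hnorm, ← dist_eq_norm, dist_comm] at hle
  exact absurd (mem_ball.1 hp) (not_lt.2 hle)

/-- Under Condition 1, a holomorphic disc in `Ω` is at least as far from the complement as its
boundary circle. -/
theorem ball_subset_of_disc (hΩ : IsOpen Ω) (hc1 : Condition1 Ω)
    {φ : ℂ → Cd d} (hφc : ContinuousOn φ (closedBall 0 1)) (hφ : DifferentiableOn ℂ φ (ball 0 1))
    (hφΩ : MapsTo φ (closedBall 0 1) Ω) {η : ℝ}
    (hη : ∀ ζ ∈ sphere (0 : ℂ) 1, ball (φ ζ) η ⊆ Ω) {ζ₀ : ℂ} (hζ₀ : ζ₀ ∈ ball (0 : ℂ) 1) :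
    ball (φ ζ₀) η ⊆ Ω := by
  match d, Ω, φ with
  | 0, _, φ =>
    intro p _
    rw [Subsingleton.elim p (φ ζ₀)]
    exact hφΩ (ball_subset_closedBall hζ₀)
  | 1, _, _ => exact ball_subset_of_disc_of_dim_one hφc hφ hφΩ hη hζ₀
  | d + 2, _, _ => exact ball_subset_of_disc_of_two_le (by omega) hΩ hc1 hφc hφ hφΩ hη hζ₀

/-! ### The continuity principle -/

/-- All boundary circles lie in a compact subset of `Ω`, hence keep a uniform distance `η` from the
complement. The discs before first contact inherit this `η`, so they cannot converge to a point
outside `Ω`. -/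
theorem Condition1.continuityPrinciple (hΩ : IsOpen Ω) (hc1 : Condition1 Ω) :
    ContinuityPrinciple Ω := by
  intro Φ hΦ hol h0 hS t ht ζ hζ
  by_contra hbad
  have hS0 : ∀ z ∈ closedBall (0 : ℂ) 1, Φ (z, 0) ∈ Ω := fun z hz => by
    rcases (mem_closedBall.1 hz).lt_or_eq with h | h
    · exact h0 z h
    · exact hS z h 0 (by simp)
  obtain ⟨z, hz, s, hs, hout, hin⟩ := exists_first_contact hΩ hΦ hS0
    ⟨ζ, ball_subset_closedBall hζ, t, ht, hbad⟩
  have hz' : z ∈ ball (0 : ℂ) 1 := by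
    rcases (mem_closedBall.1 hz).lt_or_eq with h | h
    · exact h
    · exact absurd (hS z h s ⟨hs.1.le, hs.2⟩) hout
  have hK : IsCompact (Φ '' (sphere (0 : ℂ) 1 ×ˢ Icc (0 : ℝ) 1)) :=
    ((isCompact_sphere 0 1).prod isCompact_Icc).image_of_continuousOn
      (hΦ.mono (prod_mono_left sphere_subset_closedBall))
  obtain ⟨η, hη, hηΩ⟩ := hK.exists_thickening_subset_open hΩ (by
    rintro _ ⟨⟨w, r⟩, ⟨hw, hr⟩, rfl⟩
    exact hS w hw r hr)
  have hlim := tendsto_nhdsLT_of_continuousOn hΦ hz hs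
  obtain ⟨r, hr, hrs⟩ := ((show ∀ᶠ r in 𝓝[<] s, r ∈ Ico 0 s from Ico_mem_nhdsLT hs.1).and
    (Metric.tendsto_nhds.1 hlim η hη)).exists
  have hr1 : r ∈ Icc (0 : ℝ) 1 := ⟨hr.1, hr.2.le.trans hs.2⟩
  refine hout (ball_subset_of_disc (φ := fun w => Φ (w, r)) (η := η) hΩ hc1
    (hΦ.comp (f := fun w : ℂ => (w, r)) (by fun_prop) fun w hw => ⟨hw, hr1⟩) (hol r hr1)
    (fun w hw => hin r hr w hw) (fun w hw => ?_) hz' (mem_ball'.2 hrs))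
  exact (ball_subset_thickening (mem_image_of_mem Φ (mk_mem_prod hw hr1)) η).trans hηΩ

/-! ### Plurisubharmonicity of `-log δ_Ω` -/

/-- Real parts of entire functions are dense in the continuous real functions on the unit
circle. -/
theorem exists_differentiable_re_approx {g : ℂ → ℝ} (hg : ContinuousOn g (sphere 0 1))
    {ε : ℝ} (hε : 0 < ε) :
    ∃ h : ℂ → ℂ, Differentiable ℂ h ∧ ∀ ζ ∈ sphere (0 : ℂ) 1, |g ζ - (h ζ).re| < ε := by
  have hsplit : ∀ P ∈ Submodule.span ℂ (range (@fourier 1)), ∃ h k : ℂ → ℂ,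
      Differentiable ℂ h ∧ Differentiable ℂ k ∧
        ∀ x, P x = h (AddCircle.toCircle x) + conj (k (AddCircle.toCircle x)) := by
    intro P hP
    induction hP using Submodule.span_induction with
    | mem P hP =>
      obtain ⟨n, rfl⟩ := hP
      rcases n with n | n
      · refine ⟨fun z => z ^ n, 0, by fun_prop, differentiable_const 0, fun x => ?_⟩
        simp [fourier_apply, AddCircle.toCircle_nsmul]
      · refine ⟨0, fun z => z ^ (n + 1), differentiable_const 0, by fun_prop, fun x => ?_⟩
        rw [fourier_apply, AddCircle.toCircle_zsmul, zpow_negSucc, Circle.coe_inv_eq_conj]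
        simp
    | zero => exact ⟨0, 0, differentiable_const 0, differentiable_const 0, by simp⟩
    | add P Q _ _ hP hQ =>
      obtain ⟨h, k, hh, hk, e⟩ := hP
      obtain ⟨h', k', hh', hk', e'⟩ := hQ
      refine ⟨h + h', k + k', hh.add hh', hk.add hk', fun x => ?_⟩
      simp only [ContinuousMap.add_apply, e, e', Pi.add_apply, map_add]
      ring
    | smul c P _ hP =>
      obtain ⟨h, k, hh, hk, e⟩ := hP
      refine ⟨c • h, conj c • k, hh.const_smul c, hk.const_smul _, fun x => ?_⟩
      simp only [ContinuousMap.smul_apply, e, Pi.smul_apply, smul_eq_mul, map_mul, Complex.conj_conj]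
      ring
  let G : C(AddCircle (1 : ℝ), ℂ) :=
    ⟨fun x => (g (AddCircle.toCircle x) : ℂ), Complex.continuous_ofReal.comp
      (hg.comp_continuous (continuous_subtype_val.comp AddCircle.continuous_toCircle)
        fun x => mem_sphere_zero_iff_norm.2 (Circle.norm_coe _))⟩
  have hG : G ∈ (Submodule.span ℂ (range (@fourier 1))).topologicalClosure := by
    rw [span_fourier_closure_eq_top]; trivial
  obtain ⟨P, hP, hPG⟩ := Metric.mem_closure_iff.1 hG ε hε
  obtain ⟨h, k, hh, hk, e⟩ := hsplit P hP
  -- On the circle `h + conj k` and `h + k` have the same real part.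
  refine ⟨h + k, hh.add hk, fun ζ hζ => ?_⟩
  obtain ⟨x, hx⟩ := (AddCircle.homeomorphCircle (T := 1) one_ne_zero).surjective
    ⟨ζ, by simpa [Submonoid.unitSphere] using hζ⟩
  rw [AddCircle.homeomorphCircle_apply] at hx
  have hx' : (AddCircle.toCircle x : ℂ) = ζ := by rw [hx]
  have h1 := (ContinuousMap.dist_apply_le_dist (f := G) (g := P) x).trans_lt hPG
  rw [dist_eq_norm] at h1
  refine lt_of_eq_of_lt ?_ ((Complex.abs_re_le_norm _).trans_lt h1)
  rw [e, hx']
  simp [G, hx']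

theorem bdryDist_pos (hΩ : IsOpen Ω) (hne : (frontier Ω).Nonempty)
    {x : Cd d} (hx : x ∈ Ω) : 0 < bdryDist Ω x :=
  (isClosed_frontier.notMem_iff_infDist_pos hne).1 fun h =>
    (disjoint_frontier_iff_isOpen.2 hΩ).le_bot ⟨h, hx⟩

theorem le_bdryDist_of_ball_subset (hΩ : IsOpen Ω) (hne : (frontier Ω).Nonempty)
    {x : Cd d} {r : ℝ} (h : ball x r ⊆ Ω) : r ≤ bdryDist Ω x :=
  (le_infDist hne).2 fun y hy => by
    by_contra hlt
    exact (disjoint_frontier_iff_isOpen.2 hΩ).le_bot ⟨hy, h (mem_ball'.2 (not_le.1 hlt))⟩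

theorem ball_bdryDist_subset (hne : (frontier Ω).Nonempty) {x : Cd d} (hx : x ∈ Ω) :
    ball x (bdryDist Ω x) ⊆ Ω := by
  have huniv : Ω ≠ univ := by
    rintro rfl
    simp at hne
  obtain ⟨y, hy, hxy⟩ := exists_mem_frontier_infDist_compl_eq_dist hx huniv
  intro z hz
  by_contra hzΩ
  have h1 : infDist x Ωᶜ ≤ dist x z := infDist_le_dist_of_mem hzΩ
  have h2 : bdryDist Ω x ≤ dist x y := infDist_le_dist_of_mem hy
  linarith [mem_ball'.1 hz]

theorem continuous_bdryDist : Continuous (bdryDist Ω) := continuous_infDist_pt _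

/-- The continuity principle makes `-log δ_Ω` plurisubharmonic. -/
theorem ContinuityPrinciple.isContPlurisubharmonic_neg_log (hcp : ContinuityPrinciple Ω)
    (hΩ : IsOpen Ω) (hne : (frontier Ω).Nonempty) :
    IsContPlurisubharmonic Ω fun z => -Real.log (bdryDist Ω z) := by
  have hpos : ∀ x ∈ Ω, 0 < bdryDist Ω x := fun x hx =>
    bdryDist_pos hΩ hne hx
  have hcont : ContinuousOn (fun z => -Real.log (bdryDist Ω z)) Ω :=
    (continuous_bdryDist.continuousOn.log fun x hx => (hpos x hx).ne').neg
  refine ⟨hcont, fun a b hab => ?_⟩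
  have hgc : ContinuousOn (fun ζ : ℂ => -Real.log (bdryDist Ω (a + ζ • b))) (sphere 0 1) :=
    hcont.comp (f := fun ζ : ℂ => a + ζ • b) (by fun_prop)
      fun ζ hζ => hab ζ (sphere_subset_closedBall hζ)
  have ha : a ∈ Ω := by simpa using hab 0 (by simp)
  refine le_of_forall_pos_le_add fun ε hε => ?_
  obtain ⟨h, hh, hgh⟩ := exists_differentiable_re_approx hgc (half_pos hε)
  -- The shift by `ε / 2` absorbs the approximation error, so that `r ≤ δ_Ω` on the boundary circle.
  set r : ℂ → ℝ := fun ζ => Real.exp (-((h ζ).re + ε / 2)) with hr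
  have hball : ball a (r 0) ⊆ Ω := by
    intro p hp
    set E : ℂ → ℂ := fun ζ => Complex.exp (-(h ζ + (ε / 2 : ℝ))) with hE
    have hEn : ∀ ζ, ‖E ζ‖ = r ζ := fun ζ => by
      rw [hE, Complex.norm_exp, Complex.neg_re, Complex.add_re, Complex.ofReal_re]
    have hEd : Differentiable ℂ E := by fun_prop
    have hE0 : E 0 ≠ 0 := Complex.exp_ne_zero _
    set c : Cd d := (E 0)⁻¹ • (p - a) with hc
    have hcn : ‖c‖ < 1 := by
      rw [mem_ball_iff_norm] at hp
      rw [hc, norm_smul, norm_inv, hEn, inv_mul_lt_one₀ (Real.exp_pos _)]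
      exact hp
    have hEc := hEd.continuous
    -- Hartogs' family: the affine disc is pushed by `t E(ζ) c`. On the circle the push is shorter
    -- than `|E| = r ≤ δ_Ω`; at `t = 1` the centre lands on `p`.
    have := hcp (fun q => a + q.1 • b + q.2 • E q.1 • c)
      (Continuous.continuousOn (by fun_prop)) (fun t _ => ?_) (fun ζ hζ => ?_)
      (fun ζ hζ t ht => ?_) 1 (by simp) 0 (by simp)
    · simpa [hc, smul_smul, mul_inv_cancel₀ hE0] using this
    · have h1 : Differentiable ℂ fun ζ : ℂ => a + ζ • b := by fun_prop
      have h2 : Differentiable ℂ fun ζ : ℂ => E ζ • c := by fun_prop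
      exact (h1.add (h2.const_smul t)).differentiableOn
    · simpa using hab ζ (ball_subset_closedBall hζ)
    · have hmem := hab ζ (sphere_subset_closedBall hζ)
      refine ball_bdryDist_subset hne hmem ?_
      have hrle : r ζ ≤ bdryDist Ω (a + ζ • b) := by
        rw [← Real.le_log_iff_exp_le (hpos _ hmem)]
        have := abs_lt.1 (hgh ζ hζ)
        linarith
      rw [mem_ball_iff_norm, add_sub_cancel_left, norm_smul, norm_smul, hEn,
        Real.norm_of_nonneg ht.1]
      have hrpos : 0 < r ζ := Real.exp_pos _
      calc t * (r ζ * ‖c‖) ≤ 1 * (r ζ * ‖c‖) := by gcongr; exact ht.2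
        _ < r ζ := by rw [one_mul]; exact mul_lt_of_lt_one_right hrpos hcn
        _ ≤ _ := hrle
  have hle : r 0 ≤ bdryDist Ω a := le_bdryDist_of_ball_subset hΩ hne hball
  have h1 : -Real.log (bdryDist Ω a) ≤ (h 0).re + ε / 2 := by
    have := Real.log_le_log (Real.exp_pos _) hle
    rw [Real.log_exp] at this
    linarith
  -- The mean value property turns the bound at the centre into one by the circle average, with
  -- total error `ε`.
  have hmean : Real.circleAverage (fun ζ => (h ζ).re) 0 1 = (h 0).re := by
    have h2 : Real.circleAverage h 0 1 = h 0 := (hh.diffContOnCl).circleAverage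
    rw [← h2]
    exact Complex.reCLM.circleAverage_comp_comm hh.continuous.continuousOn.circleIntegrable'
  have hmono : (h 0).re ≤
      Real.circleAverage (fun ζ : ℂ => -Real.log (bdryDist Ω (a + ζ • b)) + ε / 2) 0 1 := by
    rw [← hmean]
    refine Real.circleAverage_mono ?_ ?_ fun ζ hζ => ?_
    · exact (Complex.continuous_re.comp hh.continuous).continuousOn.circleIntegrable'
    · exact (ContinuousOn.add (by simpa using hgc) continuousOn_const).circleIntegrable'
    · have := abs_lt.1 (hgh ζ (by simpa using hζ))
      linarith
  rw [Real.circleAverage_fun_add (hgc.circleIntegrable (by norm_num))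
    (continuousOn_const.circleIntegrable (by norm_num)), Real.circleAverage_const] at hmono
  linarith

/-! ### The exhaustion function -/

theorem isPseudoconvex_of_continuityPrinciple (hΩ : IsBoundedDomain Ω)
    (hcp : ContinuityPrinciple Ω) : IsPseudoconvex Ω := by
  obtain ⟨hopen, hconn, hbdd⟩ := hΩ
  refine ⟨hopen, ?_⟩
  -- For `d = 0` the domain is the whole one-point space and has empty frontier, so the zero
  -- function is used.
  rcases Nat.eq_zero_or_pos d with rfl | hd
  · refine ⟨0, ⟨continuousOn_const, fun a b _ => ?_⟩, fun c => (Set.toFinite _).isCompact⟩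
    simp [Real.circleAverage_const]
  have hne : (frontier Ω).Nonempty := by
    have : Nonempty (Fin d) := ⟨⟨0, hd⟩⟩
    rw [nonempty_frontier_iff]
    refine ⟨hconn.nonempty, ?_⟩
    rintro rfl
    exact NormedSpace.unbounded_univ ℂ (Cd d) hbdd
  refine ⟨_, hcp.isContPlurisubharmonic_neg_log hopen hne, fun c => ?_⟩
  -- Sublevel sets are rewritten as closed subsets of the compact closure of `Ω`; `δ_Ω > 0` excludes
  -- frontier points.
  have heq : {z | z ∈ Ω ∧ -Real.log (bdryDist Ω z) ≤ c} =
      closure Ω ∩ {z | Real.exp (-c) ≤ bdryDist Ω z} := by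
    ext z
    constructor
    · rintro ⟨hz, hzc⟩
      refine ⟨subset_closure hz, ?_⟩
      rw [mem_ofPred_eq, ← Real.le_log_iff_exp_le
        (bdryDist_pos hopen hne hz)]
      linarith
    · rintro ⟨hz, hzc⟩
      have hpos : 0 < bdryDist Ω z := (Real.exp_pos _).trans_le hzc
      refine ⟨?_, ?_⟩
      · by_contra hzΩ
        have : z ∈ frontier Ω := ⟨hz, by rwa [hopen.interior_eq]⟩
        exact hpos.ne' (infDist_zero_of_mem this)
      · have := (Real.le_log_iff_exp_le hpos).2 hzc
        linarith
  rw [heq]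
  exact hbdd.isCompact_closure.inter_right (isClosed_le continuous_const continuous_bdryDist)

end Goldilocks

theorem proposition2 (d : ℕ) (Ω : Set (Goldilocks.Cd d)) :
    (Goldilocks.IsGoldilocks Ω → Goldilocks.IsPseudoconvex Ω) ∧
    (Goldilocks.IsBoundedDomain Ω → Goldilocks.Condition1 Ω →
      Goldilocks.IsPseudoconvex Ω ∧ Goldilocks.ContinuityPrinciple Ω) := by
  have key : Goldilocks.IsBoundedDomain Ω → Goldilocks.Condition1 Ω →
      Goldilocks.IsPseudoconvex Ω ∧ Goldilocks.ContinuityPrinciple Ω := fun hΩ hc1 =>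
    have hcp := hc1.continuityPrinciple hΩ.1
    ⟨Goldilocks.isPseudoconvex_of_continuityPrinciple hΩ hcp, hcp⟩
  exact ⟨fun h => (key h.1 h.2.1).1, key⟩
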